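/- Let $(\Omega_i,\Sigma_i,\mathbb P_i)$, $i=1,\dots,n$, be probability spaces, let $(\Omega,\Sigma,\mathbb P)$ be their product, let $\Omega^*\subseteq\Omega$ be a set of exceptional outcomes, let $X:\Omega\to\mathbb R_{\ge 0}$ be a random variable, and let $r,d\ge 0$ be real numbers. For $\omega\in\Omega$ and real $s>0$, an $(r,d)$-certificate for $X,\omega,s$ and $\Omega^*$ is a set $I\subseteq\{1,\dots,n\}$ with $|I|\le rs$ such that, for every integer $k\ge 0$, $X(\omega')\ge s-kd$ for all $\omega'\in\Omega\setminus\Omega^*$ such that $\omega_i\ne\omega'_i$ for at most $k$ indices $i\in I$. We say that $X$ is $(r,d)$-certifiable with respect to $\Omega^*$ if for every real $s>0$ and every $\omega\in\Omega\setminus\Omega^*$ with $X(\omega)\ge s$ there is an $(r,d)$-certificate for $X,\omega,s$ and $\Omega^*$. Suppose that $X$ is $(r,d)$-certifiable with respect to $\Omega^*$. Then for every real $$t>96\,d\sqrt{r\,\mathbb E[X]}+128\,r d^2+8\,\mathbb P(\Omega^*)\,\sup X$$ (the right-hand side is computed in $[0,\infty]$ with $0\cdot\infty=0$, and $\mathbb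 P$ is outer measure on non-measurable sets), the expectation $\mathbb E[X]$ is finite and $$\mathbb P\bigl(|X-\mathbb E[X]|>t\bigr)\le 4\exp\left(\frac{-t^2}{8d^2r\,(4\,\mathbb E[X]+t)}\right)+4\,\mathbb P(\Omega^*),$$ where the exponential is read as $0$ if $rd=0$. -/

import Mathlib

open MeasureTheory
open scoped NNReal ENNReal

/-- `I` is an `(r, d)`-certificate for `X`, `ω`, `s` and the set `Ex` of exceptional outcomes:
`I` has at most `r * s` elements and, for every `k`, every non-exceptional outcome `ω'` that
differs from `ω` in at most `k` of the coordinates in `I` satisfies `X ω' ≥ s - k * d`. -/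
def IsCertificate {n : ℕ} {Ω : Fin n → Type*} (X : (∀ i, Ω i) → ℝ≥0) (ω : ∀ i, Ω i) (s : ℝ)
    (Ex : Set (∀ i, Ω i)) (r d : ℝ≥0) (I : Finset (Fin n)) : Prop :=
  (I.card : ℝ) ≤ r * s ∧
    ∀ (k : ℕ) (ω' : ∀ i, Ω i), ω' ∉ Ex → {i : Fin n | i ∈ I ∧ ω i ≠ ω' i}.ncard ≤ k →
      s - k * d ≤ (X ω' : ℝ)

/-- `X` is `(r, d)`-certifiable with respect to the set `Ex` of exceptional outcomes. -/
def IsCertifiable {n : ℕ} {Ω : Fin n → Type*} (X : (∀ i, Ω i) → ℝ≥0)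
    (Ex : Set (∀ i, Ω i)) (r d : ℝ≥0) : Prop :=
  ∀ s : ℝ, 0 < s → ∀ ω : ∀ i, Ω i, ω ∉ Ex → s ≤ (X ω : ℝ) →
    ∃ I : Finset (Fin n), IsCertificate X ω s Ex r d I

/-! The engine is Talagrand's convex distance inequality. Let `ω` satisfy `X ω ≥ s` with certificate
`I`. A non-exceptional `ω'` with `X ω' ≤ s - u` must differ from `ω` in at least `u / d` of the at
most `r * s` indices of `I`. By `measure_mul_measure_le`, the probabilities of the low and high
events outside `Ex` have product at most `exp (-u² / (4 d² r s))`. Taking one event from a median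
`M` gives both tails around `M`.

The convex distance inequality is proved by induction for uniform measure on a finite power, with a
chosen point of the convex hull in place of the distance. It passes to arbitrary factors by drawing
many samples of each coordinate and averaging the finite inequality, so no measurability of a
distance function is needed.

Integrating the tails bounds `|E - M|` by `t / 2`, where `E` is the mean; the exceptional set
contributes at most its measure times `sup X`. Markov gives `M ≤ 2 * E`, and the tails at distance
`t / 2` from `M` then yield the stated exponent. -/

/-! ### Talagrand's inequality on finite powers. -/

/-- The one-variable optimisation in Talagrand's induction: `u` is the size of a section relative to
the largest one, and `l` the weight given to that section's own vector. -/
theorem exists_exp_sq_mul_rpow_le {u : ℝ} (hu : 0 < u) (hu1 : u ≤ 1) :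
    ∃ l : ℝ, 0 ≤ l ∧ l ≤ 1 ∧ Real.exp ((1 - l) ^ 2 / 4) * u ^ (-l) ≤ 2 - u := by
  set w := -Real.log u with hw
  have hw0 : 0 ≤ w := by
    have := Real.log_nonpos hu.le hu1
    linarith
  have huw : u = Real.exp (-w) := by rw [hw, neg_neg, Real.exp_log hu]
  by_cases h : w ≤ 1 / 2
  -- The minimiser of `(1 - l)² / 4 + l * w`, where `w = -log u`.
  · refine ⟨1 - 2 * w, by linarith, by linarith, ?_⟩
    have h1 : Real.exp ((1 - (1 - 2 * w)) ^ 2 / 4) * u ^ (-(1 - 2 * w))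
        = Real.exp (w - w ^ 2) := by
      rw [huw, ← Real.exp_mul, ← Real.exp_add]
      congr 1
      ring
    rw [h1, huw]
    -- Pull out the mean `-w² / 2` of the two exponents; `cosh x ≤ exp (x² / 2)` then cancels it.
    have h2 : Real.exp (w - w ^ 2) + Real.exp (-w)
        = 2 * Real.exp (-(w ^ 2 / 2)) * Real.cosh (w - w ^ 2 / 2) := by
      rw [Real.cosh_eq]
      have e1 : Real.exp (w - w ^ 2)
          = Real.exp (-(w ^ 2 / 2)) * Real.exp (w - w ^ 2 / 2) := by
        rw [← Real.exp_add]; congr 1; ring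
      have e2 : Real.exp (-w)
          = Real.exp (-(w ^ 2 / 2)) * Real.exp (-(w - w ^ 2 / 2)) := by
        rw [← Real.exp_add]; congr 1; ring
      rw [e1, e2]; ring
    have h3 : Real.cosh (w - w ^ 2 / 2) ≤ Real.exp (w ^ 2 / 2) := by
      refine (Real.cosh_le_exp_half_sq _).trans (Real.exp_le_exp.2 ?_)
      have : (w - w ^ 2 / 2) ^ 2 ≤ w ^ 2 := by
        apply pow_le_pow_left₀ <;> nlinarith
      linarith
    have h4 : Real.exp (-(w ^ 2 / 2)) * Real.exp (w ^ 2 / 2) = 1 := by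
      rw [← Real.exp_add]; simp
    have h5 := mul_le_mul_of_nonneg_left h3 (Real.exp_pos (-(w ^ 2 / 2))).le
    linarith
  · refine ⟨0, le_rfl, zero_le_one, ?_⟩
    push Not at h
    have h1 : u ≤ 2 / 3 := by
      rw [huw, Real.exp_neg]
      have := Real.add_one_le_exp w
      rw [inv_le_comm₀ (Real.exp_pos _) (by norm_num)]
      linarith
    have h2 : Real.exp (1 / 4) ≤ 4 / 3 := by
      have := Real.add_one_le_exp (-(1 / 4 : ℝ))
      rw [Real.exp_neg] at this
      have h3 := inv_le_comm₀ (a := (3 / 4 : ℝ)) (by norm_num) (Real.exp_pos (1 / 4))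
      have := inv_anti₀ (by norm_num) this
      rw [inv_inv] at this
      norm_num at this ⊢
      linarith
    norm_num at h2 ⊢
    linarith

/-- Hölder's inequality for finite sums, in geometric mean form. -/
theorem sum_rpow_mul_rpow_le {ι : Type*} (s : Finset ι) (f g : ι → ℝ)
    {a b l : ℝ} (hl : 0 ≤ l) (hl1 : l ≤ 1) (ha : 0 < a) (hb : 0 < b)
    (hf : ∀ i ∈ s, 0 ≤ f i) (hg : ∀ i ∈ s, 0 ≤ g i)
    (hfa : ∑ i ∈ s, f i ≤ a) (hgb : ∑ i ∈ s, g i ≤ b) :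
    ∑ i ∈ s, f i ^ l * g i ^ (1 - l) ≤ a ^ l * b ^ (1 - l) := by
  have h : ∀ i ∈ s, f i ^ l * g i ^ (1 - l)
      ≤ a ^ l * b ^ (1 - l) * (l * (f i / a) + (1 - l) * (g i / b)) := by
    intro i hi
    have h1 := Real.geom_mean_le_arith_mean2_weighted hl (sub_nonneg.2 hl1)
      (div_nonneg (hf i hi) ha.le) (div_nonneg (hg i hi) hb.le) (by ring)
    rw [Real.div_rpow (hf i hi) ha.le, Real.div_rpow (hg i hi) hb.le] at h1
    have hal := Real.rpow_pos_of_pos ha l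
    have hbl := Real.rpow_pos_of_pos hb (1 - l)
    calc f i ^ l * g i ^ (1 - l)
        = a ^ l * b ^ (1 - l) * (f i ^ l / a ^ l * (g i ^ (1 - l) / b ^ (1 - l))) := by
          field_simp
      _ ≤ _ := mul_le_mul_of_nonneg_left h1 (by positivity)
  refine (Finset.sum_le_sum h).trans ?_
  rw [← Finset.mul_sum, Finset.sum_add_distrib, ← Finset.mul_sum, ← Finset.mul_sum,
    ← Finset.sum_div, ← Finset.sum_div]
  have h1 : l * ((∑ i ∈ s, f i) / a) ≤ l * 1 :=
    mul_le_mul_of_nonneg_left ((div_le_one ha).2 hfa) hl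
  have h2 : (1 - l) * ((∑ i ∈ s, g i) / b) ≤ (1 - l) * 1 :=
    mul_le_mul_of_nonneg_left ((div_le_one hb).2 hgb) (sub_nonneg.2 hl1)
  have h3 : 0 ≤ a ^ l * b ^ (1 - l) := by positivity
  nlinarith

/-- The set of indicator vectors of the coordinates in which `x` differs from a point of `A`. -/
def diffVectors {n : ℕ} {α : Type*} (A : Set (Fin n → α)) (x : Fin n → α) : Set (Fin n → ℝ) :=
  (fun a => Set.indicator {i | x i ≠ a i} 1) '' A

/-- Prepending `e` sends difference vectors of the section at `c` to difference vectors of `A`. It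
is an affine map, so it respects convex hulls. -/
theorem cons_mem_convexHull_diffVectors {n : ℕ} {α : Type*} [DecidableEq α] {A : Set (Fin (n + 1) → α)}
    {c x : α} {y : Fin n → α} {v : Fin n → ℝ} {e : ℝ} (he : e = if x = c then 0 else 1)
    (hv : v ∈ convexHull ℝ (diffVectors {z | Fin.cons c z ∈ A} y)) :
    (Fin.cons e v : Fin (n + 1) → ℝ) ∈ convexHull ℝ (diffVectors A (Fin.cons x y)) := by
  have hsub : convexHull ℝ (diffVectors {z | Fin.cons c z ∈ A} y) ⊆
      {v | (Fin.cons e v : Fin (n + 1) → ℝ) ∈ convexHull ℝ (diffVectors A (Fin.cons x y))} := by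
    apply convexHull_min
    · rintro _ ⟨z, hz, rfl⟩
      apply subset_convexHull
      refine ⟨_, hz, ?_⟩
      funext i
      refine Fin.cases ?_ (fun j => ?_) i
      · by_cases h : x = c <;> simp [he, h]
      · simp [Set.indicator]
    · intro v hv w hw s t hs ht hst
      have := convex_convexHull ℝ (diffVectors A (Fin.cons x y)) hv hw hs ht hst
      simp only [Set.mem_ofPred_eq]
      convert this using 1
      funext i
      refine Fin.cases ?_ (fun j => ?_) i
      · simp [← add_mul, hst]
      · simp
  exact hsub hv

theorem sum_pi_succ {n : ℕ} {α M : Type*} [Fintype α] [AddCommMonoid M]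
    (f : (Fin (n + 1) → α) → M) :
    ∑ x, f x = ∑ c, ∑ y : Fin n → α, f (Fin.cons c y) := by
  rw [← Fintype.sum_prod_type' (fun c (y : Fin n → α) => f (Fin.cons c y))]
  exact (Fintype.sum_equiv (Fin.consEquiv (fun _ => α)) _ _ (fun _ => rfl)).symm

/-- Convexity of the square in each coordinate, exponentiated into the form Hölder's inequality
needs. -/
theorem talagrand_section {n : ℕ} (a b : Fin n → ℝ) {l : ℝ} (hl : 0 ≤ l) (hl1 : l ≤ 1) :
    Real.exp ((∑ i, (l * a i + (1 - l) * b i) ^ 2) / 4) ≤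
      Real.exp ((∑ i, a i ^ 2) / 4) ^ l * Real.exp ((∑ i, b i ^ 2) / 4) ^ (1 - l) := by
  rw [← Real.exp_mul, ← Real.exp_mul, ← Real.exp_add, Real.exp_le_exp]
  have : ∑ i, (l * a i + (1 - l) * b i) ^ 2 ≤ ∑ i, (l * a i ^ 2 + (1 - l) * b i ^ 2) := by
    refine Finset.sum_le_sum fun i _ => ?_
    nlinarith [mul_nonneg (mul_nonneg hl (sub_nonneg.2 hl1)) (sq_nonneg (a i - b i))]
  rw [Finset.sum_add_distrib, ← Finset.mul_sum, ← Finset.mul_sum] at this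
  linarith

/-- Talagrand's convex distance inequality for the uniform measure on a finite power. -/
theorem talagrand_finite {α : Type*} [Fintype α] [Nonempty α] (n : ℕ) :
    ∀ A : Set (Fin n → α), A.Nonempty →
    ∃ v : (Fin n → α) → Fin n → ℝ, (∀ x, v x ∈ convexHull ℝ (diffVectors A x)) ∧
      (∑ x, Real.exp ((∑ i, v x i ^ 2) / 4)) * A.ncard ≤ ((Fintype.card α : ℝ) ^ n) ^ 2 := by
  classical
  induction n with
  | zero =>
    rintro A ⟨a, ha⟩
    refine ⟨fun _ => 0, fun x => subset_convexHull _ _ ⟨a, ha, ?_⟩, ?_⟩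
    · funext i; exact i.elim0
    · have : A.ncard ≤ 1 := by
        rw [Set.ncard_le_one]
        intro a _ b _
        exact Subsingleton.elim _ _
      simpa using this
  | succ n ih =>
    intro A hA
    set S : α → Set (Fin n → α) := fun c => {z | (Fin.cons c z : Fin (n + 1) → α) ∈ A} with hS
    -- Comparing with the largest section keeps every ratio `u` at most `1`.
    obtain ⟨c₀, hc₀⟩ := Finite.exists_max (fun c => (S c).ncard)
    have hcard : (A.ncard : ℝ) = ∑ c, ((S c).ncard : ℝ) := by
      have h1 : ∀ {m : ℕ} (B : Set (Fin m → α)),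
          (B.ncard : ℝ) = ∑ x, if x ∈ B then (1 : ℝ) else 0 := by
        intro m B
        rw [Finset.sum_boole, Set.ncard_eq_toFinset_card']
        congr 2
        ext; simp
      rw [h1, sum_pi_succ]
      refine Finset.sum_congr rfl fun c _ => ?_
      rw [h1]
      rfl
    have hne : (S c₀).Nonempty := by
      by_contra h
      rw [Set.not_nonempty_iff_eq_empty] at h
      have h0 : ∀ c, (S c).ncard = 0 := fun c => by
        have := hc₀ c
        rw [h, Set.ncard_empty] at this
        omega
      have : A.ncard = 0 := by
        have : (A.ncard : ℝ) = 0 := by rw [hcard]; simp [h0]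
        exact_mod_cast this
      rw [Set.ncard_eq_zero (Set.toFinite A)] at this
      exact hA.ne_empty this
    have hp₀ : 0 < ((S c₀).ncard : ℝ) := by
      exact_mod_cast (Set.ncard_pos (Set.toFinite _)).2 hne
    set K := ((Fintype.card α : ℝ) ^ n) ^ 2 with hK
    have hN : 0 < (Fintype.card α : ℝ) := by exact_mod_cast Fintype.card_pos
    have hKpos : 0 < K := by positivity
    obtain ⟨v₀, hv₀, hs₀⟩ := ih (S c₀) hne
    have hs₀' := (le_div_iff₀ hp₀).2 hs₀
    have key : ∀ c, ∃ w : (Fin n → α) → Fin (n + 1) → ℝ,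
        (∀ y, w y ∈ convexHull ℝ (diffVectors A (Fin.cons c y))) ∧
        ∑ y, Real.exp ((∑ i, w y i ^ 2) / 4) ≤
          K / (S c₀).ncard * (2 - (S c).ncard / (S c₀).ncard) := by
      intro c
      have hfirst : ∀ y, ∃ e : ℝ, 0 ≤ e ∧ e ≤ 1 ∧ (Fin.cons e (v₀ y) : Fin (n + 1) → ℝ) ∈
          convexHull ℝ (diffVectors A (Fin.cons c y)) := by
        intro y
        refine ⟨if c = c₀ then 0 else 1, ?_, ?_, cons_mem_convexHull_diffVectors rfl (hv₀ y)⟩ <;>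
        split_ifs <;> norm_num
      choose e he0 he1 hemem using hfirst
      by_cases hc : (S c).Nonempty
      · have hp : 0 < ((S c).ncard : ℝ) := by
          exact_mod_cast (Set.ncard_pos (Set.toFinite _)).2 hc
        obtain ⟨v, hv, hs⟩ := ih (S c) hc
        have hs' := (le_div_iff₀ hp).2 hs
        set u : ℝ := (S c).ncard / (S c₀).ncard with hu
        have hupos : 0 < u := by positivity
        have hu1 : u ≤ 1 := (div_le_one hp₀).2 (by exact_mod_cast hc₀ c)
        obtain ⟨l, hl, hl1, hlu⟩ := exists_exp_sq_mul_rpow_le hupos hu1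
        -- Two ways to reach `A`: stay in the section at `c`, with no mismatch in the first
        -- coordinate, or move to the section at `c₀`, paying at most `1` there. Mix them with
        -- weights `l` and `1 - l`.
        refine ⟨fun y => l • (Fin.cons 0 (v y) : Fin (n + 1) → ℝ) +
          (1 - l) • (Fin.cons (e y) (v₀ y) : Fin (n + 1) → ℝ), fun y => ?_, ?_⟩
        · exact convex_convexHull ℝ _ (cons_mem_convexHull_diffVectors (by simp) (hv y))
            (hemem y) hl (sub_nonneg.2 hl1) (by ring)
        · calc ∑ y, Real.exp ((∑ i, (l • (Fin.cons 0 (v y) : Fin (n + 1) → ℝ) +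
                (1 - l) • (Fin.cons (e y) (v₀ y) : Fin (n + 1) → ℝ)) i ^ 2) / 4)
              ≤ ∑ y, Real.exp ((1 - l) ^ 2 / 4) * (Real.exp ((∑ i, v y i ^ 2) / 4) ^ l *
                  Real.exp ((∑ i, v₀ y i ^ 2) / 4) ^ (1 - l)) := by
                refine Finset.sum_le_sum fun y _ => ?_
                refine le_trans ?_ (mul_le_mul_of_nonneg_left
                  (talagrand_section (v y) (v₀ y) hl hl1) (Real.exp_pos _).le)
                rw [← Real.exp_add, Real.exp_le_exp, Fin.sum_univ_succ]
                simp only [Pi.add_apply, Pi.smul_apply, Fin.cons_zero, Fin.cons_succ, smul_eq_mul,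
                  mul_zero, zero_add]
                have : ((1 - l) * e y) ^ 2 ≤ (1 - l) ^ 2 := by
                  rw [mul_pow]
                  exact mul_le_of_le_one_right (sq_nonneg _) (pow_le_one₀ (he0 y) (he1 y))
                linarith
            _ ≤ Real.exp ((1 - l) ^ 2 / 4) *
                  ((K / (S c).ncard) ^ l * (K / (S c₀).ncard) ^ (1 - l)) := by
                rw [← Finset.mul_sum]
                refine mul_le_mul_of_nonneg_left ?_ (Real.exp_pos _).le
                exact sum_rpow_mul_rpow_le _ _ _ hl hl1 (by positivity) (by positivity)
                  (fun _ _ => (Real.exp_pos _).le) (fun _ _ => (Real.exp_pos _).le) hs' hs₀'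
            _ = K / (S c₀).ncard * (Real.exp ((1 - l) ^ 2 / 4) * u ^ (-l)) := by
                have h1 : K / (S c).ncard = K / (S c₀).ncard * u⁻¹ := by
                  rw [hu]; field_simp
                have h2 : 0 < K / (S c₀).ncard := by positivity
                rw [h1, Real.mul_rpow h2.le (by positivity), Real.inv_rpow hupos.le,
                  ← Real.rpow_neg hupos.le]
                have h3 : (K / (S c₀).ncard) ^ l * (K / (S c₀).ncard) ^ (1 - l)
                    = K / (S c₀).ncard := by
                  rw [← Real.rpow_add h2]; simp
                linear_combination Real.exp ((1 - l) ^ 2 / 4) * u ^ (-l) * h3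
            _ ≤ _ := mul_le_mul_of_nonneg_left hlu (by positivity)
      -- An empty section is the case `u = 0`: only the move to `c₀` is available, and `exp (1/4) ≤
      -- 2` suffices.
      · rw [Set.not_nonempty_iff_eq_empty] at hc
        refine ⟨fun y => Fin.cons (e y) (v₀ y), hemem, ?_⟩
        rw [hc, Set.ncard_empty, Nat.cast_zero, zero_div, sub_zero]
        have hexp : Real.exp (1 / 4) ≤ 2 := by
          have h2 := Real.exp_one_lt_d9
          by_contra! h
          have h3 : Real.exp 1 = Real.exp (1 / 4) ^ 4 := by rw [← Real.exp_nat_mul]; norm_num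
          have h4 : (2 : ℝ) ^ 4 < Real.exp (1 / 4) ^ 4 := by gcongr
          norm_num at h4 h2
          rw [h3] at h2
          norm_num at h2
          linarith
        calc ∑ y, Real.exp ((∑ i, (Fin.cons (e y) (v₀ y) : Fin (n + 1) → ℝ) i ^ 2) / 4)
            ≤ ∑ y, 2 * Real.exp ((∑ i, v₀ y i ^ 2) / 4) := by
              refine Finset.sum_le_sum fun y _ => ?_
              refine le_trans ?_ (mul_le_mul_of_nonneg_right hexp (Real.exp_pos _).le)
              rw [← Real.exp_add, Real.exp_le_exp, Fin.sum_univ_succ]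
              simp only [Fin.cons_zero, Fin.cons_succ]
              have := pow_le_one₀ (n := 2) (he0 y) (he1 y)
              linarith
          _ ≤ _ := by
              rw [← Finset.mul_sum]
              linarith
    choose w hw hws using key
    refine ⟨fun x => w (x 0) (Fin.tail x), fun x => ?_, ?_⟩
    · have := hw (x 0) (Fin.tail x)
      rwa [Fin.cons_self_tail] at this
    · rw [sum_pi_succ]
      simp only [Fin.cons_zero, Fin.tail_cons]
      have h1 := Finset.sum_le_sum (s := Finset.univ) fun c _ => hws c
      rw [← Finset.mul_sum, Finset.sum_sub_distrib, ← Finset.sum_div, ← hcard, Finset.sum_const,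
        Finset.card_univ, nsmul_eq_mul] at h1
      refine (mul_le_mul_of_nonneg_right h1 (Nat.cast_nonneg _)).trans ?_
      have h2 : ((Fintype.card α : ℝ) ^ (n + 1)) ^ 2 = K * (Fintype.card α : ℝ) ^ 2 := by
        rw [hK]; ring
      rw [h2]
      -- With `N = card α` and `x = |A| / |S c₀|`, this is `x * (2 * N - x) = N² - (N - x)²`.
      calc K / (S c₀).ncard * (Fintype.card α * 2 - A.ncard / (S c₀).ncard) * A.ncard
          = K * (Fintype.card α ^ 2 - (Fintype.card α - A.ncard / (S c₀).ncard) ^ 2) := by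
            field_simp; ring
        _ ≤ _ := mul_le_mul_of_nonneg_left (sub_le_self _ (sq_nonneg _)) hKpos.le

/-- If every point of `B` differs from all points of `A` in at least `τ` coordinates of a set of at
most `m` coordinates, then `A` and `B` cannot both be large. -/
theorem card_mul_card_le {α : Type*} [Fintype α] [Nonempty α] {n : ℕ} (A B : Set (Fin n → α))
    {τ m : ℝ} (hτ : 0 ≤ τ) (hm : 0 < m)
    (h : ∀ b ∈ B, ∃ I : Finset (Fin n), (I.card : ℝ) ≤ m ∧
      ∀ a ∈ A, τ ≤ {i | i ∈ I ∧ b i ≠ a i}.ncard) :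
    (A.ncard : ℝ) * B.ncard ≤
      ((Fintype.card α : ℝ) ^ n) ^ 2 * Real.exp (-(τ ^ 2 / (4 * m))) := by
  classical
  rcases A.eq_empty_or_nonempty with rfl | hA
  · simp only [Set.ncard_empty, Nat.cast_zero, zero_mul]
    positivity
  obtain ⟨v, hv, hs⟩ := talagrand_finite n A hA
  have hB : ∀ b ∈ B, Real.exp (τ ^ 2 / (4 * m)) ≤ Real.exp ((∑ i, v b i ^ 2) / 4) := by
    intro b hb
    obtain ⟨I, hI, hIA⟩ := h b hb
    -- The linear functional summing over `I` is at least `τ` on every difference vector, hence on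
    -- the hull; Cauchy–Schwarz then bounds the norm of `v b` below.
    have h1 : τ ≤ ∑ i ∈ I, v b i := by
      have hsub : convexHull ℝ (diffVectors A b) ⊆ {w | τ ≤ ∑ i ∈ I, w i} := by
        apply convexHull_min
        · rintro _ ⟨a, ha, rfl⟩
          refine (hIA a ha).trans (le_of_eq ?_)
          have : {i | i ∈ I ∧ b i ≠ a i} = (I.filter fun i => b i ≠ a i : Finset (Fin n)) := by
            ext; simp
          rw [this, Set.ncard_coe_finset]
          rw [Finset.card_filter, Nat.cast_sum]
          refine Finset.sum_congr rfl fun i _ => ?_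
          by_cases hi : b i = a i <;> simp [hi]
        · intro x hx y hy s t hs ht hst
          simp only [Set.mem_ofPred_eq, Pi.add_apply, Pi.smul_apply, smul_eq_mul,
            Finset.sum_add_distrib, ← Finset.mul_sum] at *
          nlinarith
      exact hsub (hv b)
    have h2 : (∑ i ∈ I, v b i) ^ 2 ≤ I.card * ∑ i ∈ I, v b i ^ 2 := sq_sum_le_card_mul_sum_sq
    have h3 : ∑ i ∈ I, v b i ^ 2 ≤ ∑ i, v b i ^ 2 :=
      Finset.sum_le_sum_of_subset_of_nonneg (Finset.subset_univ I) fun _ _ _ => sq_nonneg _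
    have h0 : 0 ≤ ∑ i, v b i ^ 2 := Finset.sum_nonneg fun _ _ => sq_nonneg _
    have h4 : τ ^ 2 ≤ m * ∑ i, v b i ^ 2 :=
      calc τ ^ 2 ≤ (∑ i ∈ I, v b i) ^ 2 := by gcongr
        _ ≤ I.card * ∑ i ∈ I, v b i ^ 2 := h2
        _ ≤ I.card * ∑ i, v b i ^ 2 := by gcongr
        _ ≤ _ := by gcongr
    rw [Real.exp_le_exp, div_le_div_iff₀ (by positivity) (by norm_num)]
    linarith
  have h5 : (B.ncard : ℝ) * Real.exp (τ ^ 2 / (4 * m)) ≤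
      ∑ x, Real.exp ((∑ i, v x i ^ 2) / 4) := by
    rw [Set.ncard_eq_toFinset_card', ← nsmul_eq_mul]
    refine (Finset.card_nsmul_le_sum _ _ _ fun b hb => hB b (by simpa using hb)).trans ?_
    exact Finset.sum_le_sum_of_subset_of_nonneg (Finset.subset_univ _)
      fun _ _ _ => (Real.exp_pos _).le
  rw [Real.exp_neg, ← div_eq_mul_inv, le_div_iff₀ (Real.exp_pos _)]
  have := mul_le_mul_of_nonneg_right h5 (Nat.cast_nonneg (α := ℝ) A.ncard)
  linarith

/-! ### Transfer to arbitrary product measures by sampling. -/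

/-- Among `N` independent samples of each coordinate, two selections that disagree in every
coordinate are independent and distributed according to the product measure. -/
theorem measure_sample_inter {n : ℕ} {Ω : Fin n → Type*} [∀ i, MeasurableSpace (Ω i)]
    (μ : ∀ i, Measure (Ω i)) [∀ i, IsProbabilityMeasure (μ i)] {N : ℕ}
    {A B : Set (∀ i, Ω i)} (hA : MeasurableSet A) (hB : MeasurableSet B)
    {a b : Fin n → Fin N} (hab : ∀ i, a i ≠ b i) :
    Measure.pi (fun p : Fin n × Fin N => μ p.1)
      {ξ | (fun i => ξ (i, a i)) ∈ A ∧ (fun i => ξ (i, b i)) ∈ B} =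
      Measure.pi μ A * Measure.pi μ B := by
  classical
  set P := Measure.pi (fun p : Fin n × Fin N => μ p.1) with hP
  have hind : ProbabilityTheory.iIndepFun
      (fun (p : Fin n × Fin N) (ξ : ∀ q : Fin n × Fin N, Ω q.1) => ξ p) P :=
    ProbabilityTheory.iIndepFun_pi (X := fun _ x => x) fun _ => aemeasurable_id
  have hmap : ∀ c : Fin n → Fin N,
      MeasurePreserving (fun (ξ : ∀ q : Fin n × Fin N, Ω q.1) i => ξ (i, c i)) P
        (Measure.pi μ) := by
    intro c
    refine ⟨by fun_prop, ?_⟩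
    have hinj : Function.Injective (fun i => (i, c i)) := fun i j h => (Prod.ext_iff.1 h).1
    have h := (ProbabilityTheory.iIndepFun_iff_map_fun_eq_pi_map
      fun i => (measurable_pi_apply (i, c i)).aemeasurable).1
      (hind.precomp hinj)
    rw [h]
    congr 1
    funext i
    exact (measurePreserving_eval (fun p : Fin n × Fin N => μ p.1) (i, c i)).map_eq
  let S : (Fin n → Fin N) → Finset (Fin n × Fin N) := fun c => Finset.univ.image fun i => (i, c i)
  have hdisj : Disjoint (S a) (S b) := by
    rw [Finset.disjoint_left]
    intro p hp hq
    simp only [S, Finset.mem_image, Finset.mem_univ, true_and] at hp hq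
    obtain ⟨i, rfl⟩ := hp
    obtain ⟨j, hj⟩ := hq
    rw [Prod.ext_iff] at hj
    obtain ⟨rfl, hj⟩ := hj
    exact hab _ hj.symm
  have hindep := hind.indepFun_finset (S a) (S b) hdisj (by fun_prop)
  have hmem : ∀ (c : Fin n → Fin N) i, (i, c i) ∈ S c := fun c i =>
    Finset.mem_image_of_mem _ (Finset.mem_univ i)
  have hindep' := hindep.comp (φ := fun f i => f ⟨(i, a i), hmem a i⟩)
    (ψ := fun f i => f ⟨(i, b i), hmem b i⟩) (by fun_prop) (by fun_prop)
  have h := hindep'.measure_inter_preimage_eq_mul A B hA hB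
  rw [← (hmap a).measure_preimage hA.nullMeasurableSet,
    ← (hmap b).measure_preimage hB.nullMeasurableSet]
  exact h

/-- If every point of `B` differs from all points of `A` in at least `τ` coordinates of a set of at
most `m` coordinates, then `A` and `B` cannot both be likely. -/
theorem measure_mul_measure_le {n : ℕ} {Ω : Fin n → Type*} [∀ i, MeasurableSpace (Ω i)]
    (μ : ∀ i, Measure (Ω i)) [∀ i, IsProbabilityMeasure (μ i)]
    {A B : Set (∀ i, Ω i)} (hA : MeasurableSet A) (hB : MeasurableSet B)
    {τ m : ℝ} (hτ : 0 ≤ τ) (hm : 0 < m)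
    (h : ∀ b ∈ B, ∃ I : Finset (Fin n), (I.card : ℝ) ≤ m ∧
      ∀ a ∈ A, τ ≤ {i | i ∈ I ∧ b i ≠ a i}.ncard) :
    (Measure.pi μ).real A * (Measure.pi μ).real B ≤ Real.exp (-(τ ^ 2 / (4 * m))) := by
  classical
  set e := Real.exp (-(τ ^ 2 / (4 * m))) with he
  have key : ∀ N : ℕ, ((N : ℝ) / (N + 1)) ^ n *
      ((Measure.pi μ).real A * (Measure.pi μ).real B) ≤ e := by
    intro N
    set P := Measure.pi (fun p : Fin n × Fin (N + 1) => μ p.1) with hP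
    let A' : (∀ p : Fin n × Fin (N + 1), Ω p.1) → Set (Fin n → Fin (N + 1)) :=
      fun ξ => {a | (fun i => ξ (i, a i)) ∈ A}
    let B' : (∀ p : Fin n × Fin (N + 1), Ω p.1) → Set (Fin n → Fin (N + 1)) :=
      fun ξ => {b | (fun i => ξ (i, b i)) ∈ B}
    let E : (Fin n → Fin (N + 1)) → (Fin n → Fin (N + 1)) →
      Set (∀ p : Fin n × Fin (N + 1), Ω p.1) :=
      fun a b => {ξ | (fun i => ξ (i, a i)) ∈ A ∧ (fun i => ξ (i, b i)) ∈ B}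
    have hE : ∀ a b, MeasurableSet (E a b) := fun a b =>
      (measurableSet_preimage (f := fun (ξ : ∀ p : Fin n × Fin (N + 1), Ω p.1) i => ξ (i, a i))
        (by fun_prop) hA).inter
      (measurableSet_preimage (f := fun (ξ : ∀ p : Fin n × Fin (N + 1), Ω p.1) i => ξ (i, b i))
        (by fun_prop) hB)
    have hpoint : ∀ ξ, ∑ a, ∑ b, (E a b).indicator (fun _ => (1 : ℝ)) ξ ≤
        (((N + 1 : ℕ) : ℝ) ^ n) ^ 2 * e := by
      intro ξ
      have h1 : ∑ a, ∑ b, (E a b).indicator (fun _ => (1 : ℝ)) ξ =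
          (A' ξ).ncard * (B' ξ).ncard := by
        have hc : ∀ C : Set (Fin n → Fin (N + 1)),
            (C.ncard : ℝ) = ∑ x, if x ∈ C then (1 : ℝ) else 0 := by
          intro C
          rw [Finset.sum_boole, Set.ncard_eq_toFinset_card']
          congr 2
          ext; simp
        rw [hc, hc, Finset.sum_mul_sum]
        refine Finset.sum_congr rfl fun a _ => Finset.sum_congr rfl fun b _ => ?_
        rw [ite_zero_mul_ite_zero, mul_one, Set.indicator_apply]
        congr
      rw [h1]
      have := card_mul_card_le (A' ξ) (B' ξ) hτ hm (fun b hb => by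
        obtain ⟨I, hI, hIA⟩ := h _ hb
        refine ⟨I, hI, fun a ha => (hIA _ ha).trans ?_⟩
        -- Equal sample indices give equal values, so mismatches of values are mismatches of
        -- indices.
        refine Nat.cast_le.2 (Set.ncard_le_ncard ?_ (Set.toFinite _))
        rintro i ⟨hi, hne⟩
        refine ⟨hi, fun hab => hne ?_⟩
        let g : Fin (N + 1) → Ω i := fun j => ξ (i, j)
        exact congrArg g hab)
      rwa [Fintype.card_fin] at this
    have hint : ∀ a b, Integrable ((E a b).indicator (fun _ => (1 : ℝ))) P := fun a b =>
      (integrable_const 1).indicator (hE a b)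
    have hsum : ∑ a, ∑ b, P.real (E a b) ≤ (((N + 1 : ℕ) : ℝ) ^ n) ^ 2 * e := by
      have h1 : ∑ a, ∑ b, P.real (E a b) =
          ∫ ξ, ∑ a, ∑ b, (E a b).indicator (fun _ => (1 : ℝ)) ξ ∂P := by
        rw [integral_finsetSum _ fun a _ => integrable_finsetSum _ fun b _ => hint a b]
        refine Finset.sum_congr rfl fun a _ => ?_
        rw [integral_finsetSum _ fun b _ => hint a b]
        refine Finset.sum_congr rfl fun b _ => ?_
        rw [integral_indicator_const _ (hE a b), smul_eq_mul, mul_one]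
      rw [h1]
      refine (integral_mono (integrable_finsetSum _ fun a _ =>
        integrable_finsetSum _ fun b _ => hint a b) (integrable_const _) hpoint).trans ?_
      simp
    -- Keep only pairs disagreeing in every coordinate: `N ^ n` choices of `b` for each `a`. Their
    -- share `(N / (N + 1)) ^ n` of all pairs tends to `1`.
    have hlow : (((N + 1 : ℕ) : ℝ) ^ n * (N : ℝ) ^ n) *
        ((Measure.pi μ).real A * (Measure.pi μ).real B) ≤ ∑ a, ∑ b, P.real (E a b) := by
      have h1 : ∀ a, (N : ℝ) ^ n * ((Measure.pi μ).real A * (Measure.pi μ).real B) ≤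
          ∑ b, P.real (E a b) := by
        intro a
        calc (N : ℝ) ^ n * ((Measure.pi μ).real A * (Measure.pi μ).real B)
            = ∑ b ∈ Fintype.piFinset (fun i => ({a i}ᶜ : Finset (Fin (N + 1)))),
                P.real (E a b) := by
              rw [Finset.sum_congr rfl (g := fun _ =>
                (Measure.pi μ).real A * (Measure.pi μ).real B)]
              · rw [Finset.sum_const, nsmul_eq_mul, Fintype.card_piFinset]
                simp [Finset.card_compl]
              · intro b hb
                rw [Fintype.mem_piFinset] at hb
                have := measure_sample_inter μ hA hB (a := a) (b := b) fun i hi => by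
                  have := hb i
                  simp [hi] at this
                rw [Measure.real, Measure.real, Measure.real, ← ENNReal.toReal_mul, ← this]
          _ ≤ _ := Finset.sum_le_sum_of_subset_of_nonneg (Finset.subset_univ _)
              fun _ _ _ => measureReal_nonneg
      have h2 := Finset.sum_le_sum (s := Finset.univ) fun a _ => h1 a
      rw [Finset.sum_const, Finset.card_univ, nsmul_eq_mul, Fintype.card_fun, Fintype.card_fin,
        Fintype.card_fin] at h2
      push_cast at h2 ⊢
      linarith
    have h3 := hlow.trans hsum
    have hpos : (0 : ℝ) < (N + 1) ^ n := by positivity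
    push_cast at h3
    rw [div_pow, div_mul_eq_mul_div, div_le_iff₀ hpos]
    refine le_of_mul_le_mul_left ?_ hpos
    linarith
  have hlim : Filter.Tendsto (fun N : ℕ => ((N : ℝ) / (N + 1)) ^ n *
      ((Measure.pi μ).real A * (Measure.pi μ).real B)) Filter.atTop
      (nhds (1 ^ n * ((Measure.pi μ).real A * (Measure.pi μ).real B))) :=
    ((tendsto_natCast_div_add_atTop (1 : ℝ)).pow n).mul_const _
  rw [one_pow, one_mul] at hlim
  exact le_of_tendsto' hlim key

/-! ### Medians and the tail integral. -/

/-- The lower `1/2`-quantile works: right continuity of the distribution function gives one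
inequality, its left limit the other. -/
theorem exists_median {Ω : Type*} [MeasurableSpace Ω] (P : Measure Ω) [IsProbabilityMeasure P]
    {f : Ω → ℝ} (hf : Measurable f) :
    ∃ M : ℝ, 1 / 2 ≤ P.real {ω | f ω ≤ M} ∧ 1 / 2 ≤ P.real {ω | M ≤ f ω} := by
  have := Measure.isProbabilityMeasure_map (μ := P) hf.aemeasurable
  set ν := P.map f with hν
  set F := ProbabilityTheory.cdf ν with hF
  set T := {x : ℝ | 1 / 2 ≤ F x} with hT
  have hmono : Monotone F := ProbabilityTheory.monotone_cdf ν
  have hne : T.Nonempty :=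
    ((ProbabilityTheory.tendsto_cdf_atTop ν).eventually_const_le (by norm_num)).exists
  have hbdd : BddBelow T := by
    obtain ⟨y, hy⟩ := ((ProbabilityTheory.tendsto_cdf_atBot ν).eventually_lt_const
      (show (0 : ℝ) < 1 / 2 by norm_num)).exists
    refine ⟨y, fun x hx => ?_⟩
    by_contra! h
    exact absurd (hx.trans (hmono h.le)) (not_le.2 hy)
  refine ⟨sInf T, ?_, ?_⟩
  · have h1 : 1 / 2 ≤ F (sInf T) := by
      have hc := (F.right_continuous (sInf T)).mono Set.Ioi_subset_Ici_self
      refine ge_of_tendsto hc ?_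
      filter_upwards [self_mem_nhdsWithin] with x hx
      obtain ⟨y, hy, hyx⟩ := exists_lt_of_csInf_lt hne hx
      exact le_trans hy (hmono hyx.le)
    rw [hF, ProbabilityTheory.cdf_eq_real, hν, map_measureReal_apply hf measurableSet_Iic] at h1
    exact h1
  · have h1 : ν.real (Set.Iio (sInf T)) ≤ 1 / 2 := by
      have h2 : Function.leftLim F (sInf T) ≤ 1 / 2 := by
        refine le_of_tendsto (hmono.tendsto_leftLim (sInf T)) ?_
        filter_upwards [self_mem_nhdsWithin] with x hx
        by_contra! h
        exact absurd (csInf_le hbdd (show x ∈ T from h.le)) (not_le.2 hx)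
      rw [← ProbabilityTheory.measure_cdf ν, Measure.real, StieltjesFunction.measure_Iio _
        (ProbabilityTheory.tendsto_cdf_atBot ν), sub_zero]
      exact ENNReal.toReal_le_of_le_ofReal (by norm_num) (ENNReal.ofReal_le_ofReal h2)
    have h3 := probReal_add_probReal_compl (μ := ν) (measurableSet_Iio (a := sInf T))
    rw [Set.compl_Iio] at h3
    have h4 : ν.real (Set.Ici (sInf T)) = P.real {ω | sInf T ≤ f ω} := by
      rw [hν, map_measureReal_apply hf measurableSet_Ici]; rfl
    rw [← h4]
    linarith

/-- The tail bound integrates to at most the sum of a Gaussian and an exponential integral. -/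
theorem lintegral_exp_tail_le {c M : ℝ} (hc : 0 < c) (hM : 0 ≤ M) :
    ∫⁻ u in Set.Ioi (0 : ℝ), ENNReal.ofReal (Real.exp (-(u ^ 2 / (c * (M + u))))) ≤
      ENNReal.ofReal (√(2 * Real.pi * c * M) / 2 + 2 * c) := by
  have hexp : IntegrableOn (fun u : ℝ => Real.exp (-(1 / (2 * c)) * u)) (Set.Ioi 0) :=
    integrableOn_exp_mul_Ioi (by rw [neg_lt_zero]; positivity) 0
  have hexpi : ∫ u in Set.Ioi (0 : ℝ), Real.exp (-(1 / (2 * c)) * u) = 2 * c := by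
    rw [integral_exp_mul_Ioi (by rw [neg_lt_zero]; positivity)]
    simp
  have main : ∀ g : ℝ → ℝ, IntegrableOn g (Set.Ioi 0) →
      ∫ u in Set.Ioi (0 : ℝ), g u = √(2 * Real.pi * c * M) / 2 →
      (∀ u, 0 ≤ g u) →
      (∀ u, 0 < u → Real.exp (-(u ^ 2 / (c * (M + u)))) ≤
        g u + Real.exp (-(1 / (2 * c)) * u)) →
      ∫⁻ u in Set.Ioi (0 : ℝ), ENNReal.ofReal (Real.exp (-(u ^ 2 / (c * (M + u))))) ≤
        ENNReal.ofReal (√(2 * Real.pi * c * M) / 2 + 2 * c) := by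
    intro g hg hgi hg0 hle
    rw [← hgi, ← hexpi, ← integral_add hg hexp,
      ofReal_integral_eq_lintegral_ofReal
        (f := fun u => g u + Real.exp (-(1 / (2 * c)) * u)) (hg.add hexp)
        (Filter.Eventually.of_forall fun u => add_nonneg (hg0 u) (Real.exp_pos _).le)]
    exact setLIntegral_mono' measurableSet_Ioi fun u hu => ENNReal.ofReal_le_ofReal (hle u hu)
  have hbig : ∀ u, 0 < u → M ≤ u →
      Real.exp (-(u ^ 2 / (c * (M + u)))) ≤ Real.exp (-(1 / (2 * c)) * u) := by
    intro u hu hMu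
    rw [Real.exp_le_exp, neg_mul, neg_le_neg_iff, div_mul_eq_mul_div,
      div_le_div_iff₀ (by positivity) (by positivity)]
    nlinarith [mul_nonneg (mul_pos hc hu).le (sub_nonneg.2 hMu)]
  -- The Gaussian dominates for `u ≤ M`, the exponential for `u ≥ M`. At `M = 0` the Gaussian rate
  -- degenerates, and the exponential alone suffices.
  rcases hM.eq_or_lt with rfl | hM
  · refine main (fun _ => 0) (integrable_zero _ _ _) (by simp) (fun _ => le_rfl) fun u hu => ?_
    rw [zero_add (Real.exp _)]
    exact hbig u hu hu.le
  · refine main (fun u => Real.exp (-(1 / (2 * c * M)) * u ^ 2))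
      (integrable_exp_neg_mul_sq (by positivity)).integrableOn ?_
      (fun _ => (Real.exp_pos _).le) fun u hu => ?_
    · rw [integral_gaussian_Ioi]
      congr 2
      field_simp
    · rcases le_total M u with h | h
      · exact (hbig u hu h).trans (le_add_of_nonneg_left (Real.exp_pos _).le)
      · refine le_trans ?_ (le_add_of_nonneg_right (Real.exp_pos _).le)
        rw [Real.exp_le_exp, neg_mul, neg_le_neg_iff, div_mul_eq_mul_div, one_mul]
        gcongr u ^ 2 / ?_
        nlinarith

/-! ### Tails of certifiable variables around a median. -/

section Certifiable

variable {n : ℕ} {Ω : Fin n → Type*} {X : (∀ i, Ω i) → ℝ≥0} {Ex : Set (∀ i, Ω i)} {r d : ℝ≥0}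

theorem IsCertifiable.mono {Ex' : Set (∀ i, Ω i)} (h : IsCertifiable X Ex r d) (hE : Ex ⊆ Ex') :
    IsCertifiable X Ex' r d := by
  intro s hs ω hω hsω
  obtain ⟨I, hI, hIX⟩ := h s hs ω (fun hx => hω (hE hx)) hsω
  exact ⟨I, hI, fun k ω' hω' => hIX k ω' fun hx => hω' (hE hx)⟩

/-- If `r = 0` or `d = 0`, a certifiable random variable is constant off the exceptional set. -/
theorem IsCertifiable.eq_of_degenerate (h : IsCertifiable X Ex r d) (hrd : r = 0 ∨ d = 0)
    {ω ω' : ∀ i, Ω i} (hω : ω ∉ Ex) (hω' : ω' ∉ Ex) : X ω = X ω' := by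
  have key : ∀ ω ω', ω ∉ Ex → ω' ∉ Ex → X ω ≤ X ω' := by
    intro ω ω' hω hω'
    rcases eq_or_ne (X ω) 0 with h0 | h0
    · rw [h0]; exact zero_le
    obtain ⟨I, hI, hIX⟩ := h (X ω) (by exact_mod_cast pos_iff_ne_zero.2 h0) ω hω le_rfl
    have := hIX _ ω' hω' le_rfl
    rcases hrd with rfl | rfl
    · have hI0 : I = ∅ := by
        rw [← Finset.card_eq_zero]
        have : (I.card : ℝ) ≤ 0 := by simpa using hI
        exact_mod_cast le_antisymm this (Nat.cast_nonneg _)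
      subst hI0
      simpa using this
    · simpa using this
  exact le_antisymm (key _ _ hω hω') (key _ _ hω' hω)

variable [∀ i, MeasurableSpace (Ω i)] (μ : ∀ i, Measure (Ω i)) [∀ i, IsProbabilityMeasure (μ i)]

/-- A certificate at level `s` forces at least `u / d` mismatches on at most `r * s` indices, so `τ
= u / d` and `m = r * s`. -/
theorem IsCertifiable.measureReal_mul_le (h : IsCertifiable X Ex r d) (hX : Measurable X)
    (hEx : MeasurableSet Ex) (hr : 0 < r) (hd : 0 < d) {s u : ℝ} (hs : 0 < s) (hu : 0 ≤ u) :
    (Measure.pi μ).real ({ω | (X ω : ℝ) ≤ s - u} \ Ex) *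
      (Measure.pi μ).real ({ω | s ≤ (X ω : ℝ)} \ Ex) ≤
      Real.exp (-(u ^ 2 / (4 * d ^ 2 * r * s))) := by
  have hXr : Measurable fun ω => (X ω : ℝ) := hX.coe_nnreal_real
  have hr' : (0 : ℝ) < r := hr
  have hd' : (0 : ℝ) < d := hd
  have := measure_mul_measure_le μ (A := {ω | (X ω : ℝ) ≤ s - u} \ Ex)
    (B := {ω | s ≤ (X ω : ℝ)} \ Ex)
    ((measurableSet_le hXr measurable_const).diff hEx)
    ((measurableSet_le measurable_const hXr).diff hEx)
    (τ := u / d) (m := r * s) (by positivity) (by positivity) (by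
      rintro ω ⟨hsω, hω⟩
      obtain ⟨I, hI, hIX⟩ := h s hs ω hω hsω
      refine ⟨I, hI, ?_⟩
      rintro ω' ⟨hω's, hω'⟩
      have h1 := hIX _ ω' hω' le_rfl
      rw [div_le_iff₀ hd']
      have h2 : (X ω' : ℝ) ≤ s - u := hω's
      linarith)
  refine this.trans (le_of_eq ?_)
  congr 2
  field_simp

variable {M : ℝ}

theorem IsCertifiable.upper_tail (h : IsCertifiable X Ex r d) (hX : Measurable X)
    (hEx : MeasurableSet Ex) (hr : 0 < r) (hd : 0 < d) (hM0 : 0 ≤ M)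
    (hM : 1 / 2 ≤ (Measure.pi μ).real {ω | (X ω : ℝ) ≤ M}) {u : ℝ} (hu : 0 < u) :
    (1 / 2 - (Measure.pi μ).real Ex) * (Measure.pi μ).real ({ω | M + u ≤ (X ω : ℝ)} \ Ex) ≤
      Real.exp (-(u ^ 2 / (4 * d ^ 2 * r * (M + u)))) := by
  have h1 := h.measureReal_mul_le μ hX hEx hr hd (s := M + u) (u := u) (by positivity) hu.le
  rw [add_sub_cancel_right] at h1
  have h2 := measureReal_sdiff_add_inter (μ := Measure.pi μ) (s := {ω | (X ω : ℝ) ≤ M}) hEx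
  have h3 := measureReal_mono (μ := Measure.pi μ) (Set.inter_subset_right
    (s := {ω | (X ω : ℝ) ≤ M}) (t := Ex))
  refine le_trans ?_ h1
  gcongr
  linarith

theorem IsCertifiable.lower_tail (h : IsCertifiable X Ex r d) (hX : Measurable X)
    (hEx : MeasurableSet Ex) (hr : 0 < r) (hd : 0 < d) (hM0 : 0 ≤ M)
    (hM : 1 / 2 ≤ (Measure.pi μ).real {ω | M ≤ (X ω : ℝ)}) {u : ℝ} (hu : 0 < u) :
    (1 / 2 - (Measure.pi μ).real Ex) * (Measure.pi μ).real ({ω | (X ω : ℝ) ≤ M - u} \ Ex) ≤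
      Real.exp (-(u ^ 2 / (4 * d ^ 2 * r * (M + u)))) := by
  have hr' : (0 : ℝ) < r := hr
  have hd' : (0 : ℝ) < d := hd
  -- Certificates need a positive level; at `M = 0` the event is empty since `X ≥ 0`.
  rcases hM0.eq_or_lt with rfl | hM0
  · have : {ω | (X ω : ℝ) ≤ 0 - u} = ∅ := by
      ext ω
      have := (X ω).coe_nonneg
      simp only [Set.mem_ofPred_eq, Set.mem_empty_iff_false, iff_false, not_le]
      linarith
    rw [this, Set.empty_sdiff, measureReal_empty, mul_zero]
    positivity
  have h1 := h.measureReal_mul_le μ hX hEx hr hd (s := M) (u := u) hM0 hu.le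
  have h2 := measureReal_sdiff_add_inter (μ := Measure.pi μ) (s := {ω | M ≤ (X ω : ℝ)}) hEx
  have h3 := measureReal_mono (μ := Measure.pi μ) (Set.inter_subset_right
    (s := {ω | M ≤ (X ω : ℝ)}) (t := Ex))
  calc _ ≤ (Measure.pi μ).real ({ω | M ≤ (X ω : ℝ)} \ Ex) *
        (Measure.pi μ).real ({ω | (X ω : ℝ) ≤ M - u} \ Ex) := by
        gcongr
        linarith
    _ ≤ Real.exp (-(u ^ 2 / (4 * d ^ 2 * r * M))) := by rwa [mul_comm]
    _ ≤ _ := by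
        rw [Real.exp_le_exp, neg_le_neg_iff]
        gcongr
        linarith

/-- On `Ex`, both `X` and `M` lie in `[0, sup X]`. Off `Ex`, integrate the tails: `1/2 - P(Ex) ≥
1/4` costs a factor `4` for each of two tails, hence the `8`. -/
theorem IsCertifiable.lintegral_abs_sub_le (h : IsCertifiable X Ex r d) (hX : Measurable X)
    (hEx : MeasurableSet Ex) (hr : 0 < r) (hd : 0 < d) (hM0 : 0 ≤ M)
    (hM : 1 / 2 ≤ (Measure.pi μ).real {ω | (X ω : ℝ) ≤ M})
    (hM' : 1 / 2 ≤ (Measure.pi μ).real {ω | M ≤ (X ω : ℝ)})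
    (hp : (Measure.pi μ).real Ex ≤ 1 / 4) :
    ∫⁻ ω, ENNReal.ofReal |(X ω : ℝ) - M| ∂(Measure.pi μ) ≤
      Measure.pi μ Ex * (⨆ ω, (X ω : ℝ≥0∞)) +
        ENNReal.ofReal (8 * (√(2 * Real.pi * (4 * d ^ 2 * r) * M) / 2 + 2 * (4 * d ^ 2 * r))) := by
  have hXr : Measurable fun ω => (X ω : ℝ) := hX.coe_nnreal_real
  have habs : Measurable fun ω => |(X ω : ℝ) - M| := (hXr.sub measurable_const).norm
  have hr' : (0 : ℝ) < r := hr
  have hd' : (0 : ℝ) < d := hd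
  rw [← lintegral_add_compl _ hEx]
  gcongr
  · obtain ⟨ω₀, hω₀⟩ : {ω | M ≤ (X ω : ℝ)}.Nonempty := by
      by_contra hne
      rw [Set.not_nonempty_iff_eq_empty] at hne
      rw [hne, measureReal_empty] at hM'
      norm_num at hM'
    have hsup : ∀ ω, ENNReal.ofReal |(X ω : ℝ) - M| ≤ ⨆ ω, (X ω : ℝ≥0∞) := by
      intro ω
      have h1 : |(X ω : ℝ) - M| ≤ max (X ω : ℝ) (X ω₀) := by
        have h2 : M ≤ X ω₀ := hω₀
        rw [abs_le]
        constructor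
        · linarith [le_max_right (X ω : ℝ) (X ω₀), (X ω).coe_nonneg]
        · linarith [le_max_left (X ω : ℝ) (X ω₀)]
      refine (ENNReal.ofReal_le_ofReal h1).trans ?_
      rw [ENNReal.ofReal_max, ENNReal.ofReal_coe_nnreal, ENNReal.ofReal_coe_nnreal]
      exact max_le (le_iSup (fun ω => (X ω : ℝ≥0∞)) ω) (le_iSup (fun ω => (X ω : ℝ≥0∞)) ω₀)
    calc ∫⁻ ω in Ex, ENNReal.ofReal |(X ω : ℝ) - M| ∂(Measure.pi μ)
        ≤ ∫⁻ _ in Ex, (⨆ ω, (X ω : ℝ≥0∞)) ∂(Measure.pi μ) := lintegral_mono hsup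
      _ = _ := by rw [setLIntegral_const, mul_comm]
  · rw [lintegral_eq_lintegral_meas_le _ (Filter.Eventually.of_forall fun _ => abs_nonneg _)
      habs.aemeasurable, ENNReal.ofReal_mul (by norm_num)]
    refine le_trans ?_ (mul_le_mul_right (lintegral_exp_tail_le (c := 4 * d ^ 2 * r)
      (by positivity) hM0) _)
    rw [← lintegral_const_mul' _ _ ENNReal.ofReal_ne_top]
    refine setLIntegral_mono' measurableSet_Ioi fun u hu => ?_
    rw [← ENNReal.ofReal_mul (by norm_num),
      Measure.restrict_apply (measurableSet_le measurable_const habs),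
      ← ofReal_measureReal]
    refine ENNReal.ofReal_le_ofReal ?_
    have h1 := h.upper_tail μ hX hEx hr hd hM0 hM hu
    have h2 := h.lower_tail μ hX hEx hr hd hM0 hM' hu
    have hsub : {ω | u ≤ |(X ω : ℝ) - M|} ∩ Exᶜ ⊆
        ({ω | M + u ≤ (X ω : ℝ)} \ Ex) ∪ ({ω | (X ω : ℝ) ≤ M - u} \ Ex) := by
      rintro ω ⟨hω, hωE⟩
      rcases le_abs.1 (show u ≤ |(X ω : ℝ) - M| from hω) with h | h
      · exact Or.inl ⟨by simp only [Set.mem_ofPred_eq]; linarith, hωE⟩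
      · exact Or.inr ⟨by simp only [Set.mem_ofPred_eq]; linarith, hωE⟩
    have h3 := (measureReal_mono (μ := Measure.pi μ) hsub).trans (measureReal_union_le _ _)
    have h4 := measureReal_nonneg (μ := Measure.pi μ) (s := {ω | M + u ≤ (X ω : ℝ)} \ Ex)
    have h5 := measureReal_nonneg (μ := Measure.pi μ) (s := {ω | (X ω : ℝ) ≤ M - u} \ Ex)
    nlinarith

end Certifiable

/-! ### From the median to the mean. -/

section Concentration

variable {n : ℕ} {Ω : Fin n → Type*} {X : (∀ i, Ω i) → ℝ≥0} {Ex : Set (∀ i, Ω i)} {r d : ℝ≥0}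
variable [∀ i, MeasurableSpace (Ω i)] (μ : ∀ i, Measure (Ω i)) [∀ i, IsProbabilityMeasure (μ i)]

/-- The mean of a certifiable random variable is close to its median. -/
theorem IsCertifiable.abs_integral_sub_median_le {M : ℝ} (h : IsCertifiable X Ex r d)
    (hX : Measurable X) (hEx : MeasurableSet Ex) (hr : 0 < r) (hd : 0 < d) (hM0 : 0 ≤ M)
    (hM : 1 / 2 ≤ (Measure.pi μ).real {ω | (X ω : ℝ) ≤ M})
    (hM' : 1 / 2 ≤ (Measure.pi μ).real {ω | M ≤ (X ω : ℝ)})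
    (hp : (Measure.pi μ).real Ex ≤ 1 / 4) (hint : Integrable (fun ω => (X ω : ℝ)) (Measure.pi μ))
    (hME : M ≤ 2 * ∫ ω, (X ω : ℝ) ∂(Measure.pi μ)) {q : ℝ} (hq0 : 0 ≤ q)
    (hq : Measure.pi μ Ex * (⨆ ω, (X ω : ℝ≥0∞)) ≤ ENNReal.ofReal q) :
    |(∫ ω, (X ω : ℝ) ∂(Measure.pi μ)) - M| ≤
      q + 48 * d * √(r * ∫ ω, (X ω : ℝ) ∂(Measure.pi μ)) + 64 * r * d ^ 2 := by
  have hr' : (0 : ℝ) < r := hr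
  have hd' : (0 : ℝ) < d := hd
  set E := ∫ ω, (X ω : ℝ) ∂(Measure.pi μ) with hE
  have hE0 : 0 ≤ E := integral_nonneg fun ω => (X ω).coe_nonneg
  set g := 8 * (√(2 * Real.pi * (4 * d ^ 2 * r) * M) / 2 + 2 * (4 * d ^ 2 * r)) with hg
  have h1 : |E - M| ≤ q + g := by
    have h2 : ENNReal.ofReal |E - M| ≤ ENNReal.ofReal (q + g) := by
      have h3 : E - M = ∫ ω, ((X ω : ℝ) - M) ∂(Measure.pi μ) := by
        rw [integral_sub hint (integrable_const _)]
        simp [hE]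
      rw [h3, ← Real.enorm_eq_ofReal_abs, ENNReal.ofReal_add hq0 (by positivity)]
      refine (enorm_integral_le_lintegral_enorm _).trans ?_
      simp only [Real.enorm_eq_ofReal_abs]
      refine (h.lintegral_abs_sub_le μ hX hEx hr hd hM0 hM hM' hp).trans ?_
      gcongr
    exact (ENNReal.ofReal_le_ofReal_iff (by positivity)).1 h2
  -- `π ≤ 4` and `M ≤ 2 * E` bound the radicand by `64 d² r E`; the looser factor `12` produces the
  -- `48`.
  have h2 : √(2 * Real.pi * (4 * d ^ 2 * r) * M) ≤ 12 * d * √(r * E) := by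
    rw [show 12 * (d : ℝ) * √(r * E) = √((12 * d) ^ 2 * (r * E)) by
      rw [Real.sqrt_mul (sq_nonneg (12 * (d : ℝ))), Real.sqrt_sq (by positivity)]]
    apply Real.sqrt_le_sqrt
    calc 2 * Real.pi * (4 * d ^ 2 * r) * M ≤ 2 * 4 * (4 * d ^ 2 * r) * (2 * E) := by
          gcongr
          exact Real.pi_le_four
      _ ≤ (12 * d) ^ 2 * (r * E) := by
          have : (0 : ℝ) ≤ d ^ 2 * r * E := by positivity
          nlinarith
  rw [hg] at h1
  linarith

/-- Dividing by `1/2 - p` instead of `1/2` costs at most `3 * p` as long as `4 * e + 3 * p ≤ 3/2`,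
which `p < 1/4` and `e ≤ 3/16` ensure. -/
theorem le_four_mul_add_of_tails {p a b e : ℝ} (hp0 : 0 ≤ p) (hp : p < 1 / 4) (he : e ≤ 3 / 16)
    (ha : (1 / 2 - p) * a ≤ e) (hb : (1 / 2 - p) * b ≤ e) :
    p + (a + b) ≤ 4 * e + 4 * p := by
  have h1 : (1 / 2 - p) * (a + b) ≤ (1 / 2 - p) * (4 * e + 3 * p) := by
    nlinarith [mul_nonneg hp0 (show 0 ≤ 3 / 2 - 4 * e - 3 * p by linarith)]
  have h2 := le_of_mul_le_mul_left h1 (by linarith)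
  linarith

theorem exp_neg_five_le : Real.exp (-5) ≤ 3 / 16 := by
  rw [Real.exp_neg, inv_le_comm₀ (Real.exp_pos _) (by norm_num)]
  have := Real.add_one_le_exp (5 : ℝ)
  norm_num
  linarith

theorem five_le_exponent {r d E t : ℝ} (hr : 0 < r) (hd : 0 < d) (hE : 0 ≤ E)
    (ht : 96 * d * √(r * E) + 128 * r * d ^ 2 < t) :
    5 ≤ t ^ 2 / (8 * d ^ 2 * r * (4 * E + t)) := by
  have hs := Real.sqrt_nonneg (r * E)
  have hrd : 0 < r * d ^ 2 := by positivity
  have hds : 0 ≤ d * √(r * E) := by positivity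
  have ht0 : 0 < t := by linarith
  have h1 : 96 * (d * √(r * E)) ≤ t := by linarith
  have h2 : (96 * (d * √(r * E))) ^ 2 ≤ t ^ 2 := by gcongr
  have h3 : (d * √(r * E)) ^ 2 = d ^ 2 * (r * E) := by
    rw [mul_pow, Real.sq_sqrt (by positivity)]
  have h4 : 128 * (r * d ^ 2) * t ≤ t * t := by
    gcongr
    linarith
  rw [le_div_iff₀ (by positivity)]
  rw [mul_pow, h3] at h2
  have h5 : 0 ≤ d ^ 2 * (r * E) := by positivity
  nlinarith

/-- Talagrand's inequality for certifiable random variables, with a measurable exceptional set. -/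
theorem IsCertifiable.measureReal_abs_sub_integral_le (h : IsCertifiable X Ex r d)
    (hX : Measurable X) (hEx : MeasurableSet Ex) (hr : 0 < r) (hd : 0 < d)
    (hint : Integrable (fun ω => (X ω : ℝ)) (Measure.pi μ)) {q t : ℝ} (hq0 : 0 ≤ q)
    (hq : Measure.pi μ Ex * (⨆ ω, (X ω : ℝ≥0∞)) ≤ ENNReal.ofReal q)
    (ht : 96 * d * √(r * ∫ ω, (X ω : ℝ) ∂(Measure.pi μ)) + 128 * r * d ^ 2 + 8 * q < t) :
    (Measure.pi μ).real {ω | t < |(X ω : ℝ) - ∫ ω', (X ω' : ℝ) ∂(Measure.pi μ)|} ≤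
      4 * Real.exp (-t ^ 2 / (8 * d ^ 2 * r * (4 * (∫ ω', (X ω' : ℝ) ∂(Measure.pi μ)) + t))) +
        4 * (Measure.pi μ).real Ex := by
  have hr' : (0 : ℝ) < r := hr
  have hd' : (0 : ℝ) < d := hd
  set E := ∫ ω, (X ω : ℝ) ∂(Measure.pi μ) with hE
  have hE0 : 0 ≤ E := integral_nonneg fun ω => (X ω).coe_nonneg
  have hrd : (0 : ℝ) < r * d ^ 2 := by positivity
  have hs : 0 ≤ d * √(r * E) := by positivity
  have ht0 : 0 < t := by linarith
  rcases le_or_gt (1 / 4) ((Measure.pi μ).real Ex) with hp | hp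
  · have h1 : (Measure.pi μ).real {ω | t < |(X ω : ℝ) - E|} ≤ 1 := measureReal_le_one
    have h2 := Real.exp_pos (-t ^ 2 / (8 * d ^ 2 * r * (4 * E + t)))
    linarith
  obtain ⟨M, hM, hM'⟩ := exists_median (Measure.pi μ) hX.coe_nnreal_real
  have hM0 : 0 ≤ M := by
    by_contra! hneg
    have : {ω | (X ω : ℝ) ≤ M} = ∅ := by
      ext ω
      have := (X ω).coe_nonneg
      simp only [Set.mem_ofPred_eq, Set.mem_empty_iff_false, iff_false, not_le]
      linarith
    rw [this, measureReal_empty] at hM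
    norm_num at hM
  -- Markov's inequality at the median.
  have hME : M ≤ 2 * E := by
    have h1 := mul_meas_ge_le_integral_of_nonneg
      (Filter.Eventually.of_forall fun ω => (X ω).coe_nonneg) hint M
    have h2 := mul_le_mul_of_nonneg_left hM' hM0
    linarith
  have hdist := h.abs_integral_sub_median_le μ hX hEx hr hd hM0 hM hM' hp.le hint hME hq0 hq
  rw [← hE] at hdist
  have hdist' : |E - M| ≤ t / 2 := by linarith
  rw [abs_le] at hdist'
  set e := Real.exp (-t ^ 2 / (8 * d ^ 2 * r * (4 * E + t))) with he
  -- The left exponent is `-t² / (8 d² r (2 M + t))`, and `2 * M ≤ 4 * E`.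
  have hele : Real.exp (-((t / 2) ^ 2 / (4 * d ^ 2 * r * (M + t / 2)))) ≤ e := by
    rw [he, Real.exp_le_exp, neg_div, neg_le_neg_iff, div_le_div_iff₀ (by positivity)
      (by positivity)]
    have : 0 ≤ d ^ 2 * r * t ^ 2 * (2 * E - M) :=
      mul_nonneg (by positivity) (by linarith)
    nlinarith
  have he3 : e ≤ 3 / 16 := by
    refine le_trans ?_ exp_neg_five_le
    rw [he, Real.exp_le_exp, neg_div, neg_le_neg_iff]
    exact five_le_exponent hr' hd' hE0 (by linarith)
  have hup := (h.upper_tail μ hX hEx hr hd hM0 hM (half_pos ht0)).trans hele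
  have hlow := (h.lower_tail μ hX hEx hr hd hM0 hM' (half_pos ht0)).trans hele
  refine le_trans ?_ (le_four_mul_add_of_tails measureReal_nonneg hp he3 hup hlow)
  have hsub : {ω | t < |(X ω : ℝ) - E|} ⊆ Ex ∪
      (({ω | M + t / 2 ≤ (X ω : ℝ)} \ Ex) ∪ ({ω | (X ω : ℝ) ≤ M - t / 2} \ Ex)) := by
    intro ω hω
    by_cases hωE : ω ∈ Ex
    · exact Or.inl hωE
    rcases lt_abs.1 (show t < |(X ω : ℝ) - E| from hω) with h | h
    · exact Or.inr (Or.inl ⟨by simp only [Set.mem_ofPred_eq]; linarith, hωE⟩)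
    · exact Or.inr (Or.inr ⟨by simp only [Set.mem_ofPred_eq]; linarith, hωE⟩)
  refine (measureReal_mono hsub).trans ((measureReal_union_le _ _).trans ?_)
  gcongr
  exact measureReal_union_le _ _

/-- If `X` is constant off a measurable set `Ex`, then it is integrable and rarely far from its
mean. -/
theorem concentration_of_const_off {Ω : Type*} [MeasurableSpace Ω] (P : Measure Ω)
    [IsProbabilityMeasure P] {X : Ω → ℝ≥0} (hX : Measurable X) {Ex : Set Ω}
    (hEx : MeasurableSet Ex) (hconst : ∀ ω ω', ω ∉ Ex → ω' ∉ Ex → X ω = X ω') {t : ℝ}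
    (ht : P Ex * (⨆ ω, (X ω : ℝ≥0∞)) < ENNReal.ofReal t) :
    Integrable (fun ω => (X ω : ℝ)) P ∧
      P.real {ω | t < |(X ω : ℝ) - ∫ ω', (X ω' : ℝ) ∂P|} ≤ 4 * P.real Ex := by
  have hXr : Measurable fun ω => (X ω : ℝ) := hX.coe_nnreal_real
  have hdist : ∀ x : ℝ≥0, (x : ℝ≥0∞) ≤ (⨆ ω, (X ω : ℝ≥0∞)) → (∀ ω, ω ∉ Ex → X ω = x) →
      ∫⁻ ω, ‖(X ω : ℝ) - x‖ₑ ∂P ≤ P Ex * ⨆ ω, (X ω : ℝ≥0∞) := by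
    intro x hx hXx
    rw [← lintegral_add_compl _ hEx]
    have h1 : ∫⁻ ω in Exᶜ, ‖(X ω : ℝ) - x‖ₑ ∂P = 0 := by
      rw [setLIntegral_congr_fun (g := fun _ => 0) hEx.compl
        (fun ω hω => by simp [hXx ω hω]), lintegral_zero]
    rw [h1, add_zero, mul_comm, ← setLIntegral_const]
    refine lintegral_mono fun ω => ?_
    have h2 : |(X ω : ℝ) - x| ≤ max (X ω : ℝ) x := by
      rw [abs_le]
      constructor
      · linarith [le_max_right (X ω : ℝ) x, (X ω).coe_nonneg]
      · linarith [le_max_left (X ω : ℝ) x, x.coe_nonneg]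
    rw [Real.enorm_eq_ofReal_abs]
    refine (ENNReal.ofReal_le_ofReal h2).trans ?_
    rw [ENNReal.ofReal_max, ENNReal.ofReal_coe_nnreal, ENNReal.ofReal_coe_nnreal]
    exact max_le (le_iSup (fun ω => (X ω : ℝ≥0∞)) ω) hx
  obtain ⟨x, hx, hXx⟩ : ∃ x : ℝ≥0, (x : ℝ≥0∞) ≤ (⨆ ω, (X ω : ℝ≥0∞)) ∧
      ∀ ω, ω ∉ Ex → X ω = x := by
    by_cases hne : ∃ ω, ω ∉ Ex
    · obtain ⟨ω₀, h₀⟩ := hne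
      exact ⟨X ω₀, le_iSup (fun ω => (X ω : ℝ≥0∞)) ω₀, fun ω hω => hconst _ _ hω h₀⟩
    · exact ⟨0, by simp, fun ω hω => (hne ⟨ω, hω⟩).elim⟩
  have hlt := (hdist x hx hXx).trans_lt ht
  have hsub : Integrable (fun ω => (X ω : ℝ) - x) P :=
    ⟨(hXr.sub measurable_const).aestronglyMeasurable, hlt.trans_le le_top⟩
  have hint : Integrable (fun ω => (X ω : ℝ)) P := by
    refine (hsub.add (integrable_const (x : ℝ))).congr (Filter.Eventually.of_forall fun ω => ?_)
    simp
  refine ⟨hint, ?_⟩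
  -- The mean is within `P Ex * sup X < t` of the constant, so only exceptional outcomes can deviate
  -- by more than `t`.
  have hmean : |(x : ℝ) - ∫ ω, (X ω : ℝ) ∂P| < t := by
    have h1 : (∫ ω, (X ω : ℝ) ∂P) - x = ∫ ω, ((X ω : ℝ) - x) ∂P := by
      rw [integral_sub hint (integrable_const _)]
      simp
    have h2 := (enorm_integral_le_lintegral_enorm (μ := P) fun ω => (X ω : ℝ) - x).trans_lt hlt
    rw [← h1, Real.enorm_eq_ofReal_abs, abs_sub_comm] at h2
    exact (ENNReal.ofReal_lt_ofReal_iff_of_nonneg (abs_nonneg _)).1 h2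
  have hincl : {ω | t < |(X ω : ℝ) - ∫ ω', (X ω' : ℝ) ∂P|} ⊆ Ex := by
    intro ω hω
    by_contra hωE
    have h1 : t < |(X ω : ℝ) - ∫ ω', (X ω' : ℝ) ∂P| := hω
    rw [hXx ω hωE] at h1
    exact lt_asymm h1 hmean
  have := measureReal_mono (μ := P) hincl
  linarith [measureReal_nonneg (μ := P) (s := Ex)]

end Concentration

/-! ### The theorem for arbitrary exceptional sets. -/

theorem mainTheorem7 {n : ℕ} {Ω : Fin n → Type*} [∀ i, MeasurableSpace (Ω i)]
    (μ : ∀ i, Measure (Ω i)) [∀ i, IsProbabilityMeasure (μ i)]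
    (Ex : Set (∀ i, Ω i)) (X : (∀ i, Ω i) → ℝ≥0) (hX : Measurable X)
    (r d : ℝ≥0) (hcert : IsCertifiable X Ex r d) (t : ℝ)
    (ht : 96 * (d : ℝ≥0∞) * ((r : ℝ≥0∞) * ∫⁻ ω, (X ω : ℝ≥0∞) ∂(Measure.pi μ)) ^ (1 / 2 : ℝ)
        + 128 * (r : ℝ≥0∞) * (d : ℝ≥0∞) ^ 2
        + 8 * Measure.pi μ Ex * (⨆ ω, (X ω : ℝ≥0∞)) < ENNReal.ofReal t) :
    -- the expectation is finite
    Integrable (fun ω => (X ω : ℝ)) (Measure.pi μ) ∧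
    (Measure.pi μ).real {ω | t < |(X ω : ℝ) - ∫ ω', (X ω' : ℝ) ∂(Measure.pi μ)|}
      ≤ 4 * Real.exp (-t ^ 2 /
            (8 * (d : ℝ) ^ 2 * r * (4 * (∫ ω', (X ω' : ℝ) ∂(Measure.pi μ)) + t)))
        + 4 * (Measure.pi μ).real Ex ∧
    -- if `r = 0` or `d = 0`, the exponential is `exp (-∞) = 0`
    (r = 0 ∨ d = 0 →
      (Measure.pi μ).real {ω | t < |(X ω : ℝ) - ∫ ω', (X ω' : ℝ) ∂(Measure.pi μ)|}
        ≤ 4 * (Measure.pi μ).real Ex) := by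
  set P := Measure.pi μ with hP
  -- A measurable hull has the same outer measure, and enlarging `Ex` preserves certifiability.
  set Ex' := toMeasurable P Ex with hEx'
  have hm : MeasurableSet Ex' := measurableSet_toMeasurable P Ex
  have hcert' : IsCertifiable X Ex' r d := hcert.mono (subset_toMeasurable P Ex)
  have hPE : P Ex' = P Ex := measure_toMeasurable Ex
  have hPEr : P.real Ex' = P.real Ex := by rw [Measure.real, Measure.real, hPE]
  by_cases hrd : r = 0 ∨ d = 0
  · have hle : P Ex' * (⨆ ω, (X ω : ℝ≥0∞)) ≤ 8 * P Ex * ⨆ ω, (X ω : ℝ≥0∞) := by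
      rw [hPE, mul_assoc]
      exact le_mul_of_one_le_left zero_le (by norm_num)
    obtain ⟨hint, hbound⟩ := concentration_of_const_off P hX hm
      (fun _ _ hω hω' => hcert'.eq_of_degenerate hrd hω hω')
      ((hle.trans le_add_self).trans_lt ht)
    rw [hPEr] at hbound
    refine ⟨hint, hbound.trans ?_, fun _ => hbound⟩
    -- Here division by zero makes the formal exponential `exp 0 = 1`; the substantive bound is the
    -- last conjunct.
    exact le_add_of_nonneg_left (by positivity)
  · push Not at hrd
    have hr : 0 < r := pos_iff_ne_zero.2 hrd.1
    have hd : 0 < d := pos_iff_ne_zero.2 hrd.2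
    -- For `r, d > 0` an infinite mean would make the lower bound on `t` infinite.
    have hfin : ∫⁻ ω, (X ω : ℝ≥0∞) ∂P ≠ ∞ := by
      intro htop
      rw [htop, ENNReal.mul_top (by simpa using hrd.1), ENNReal.top_rpow_of_pos (by norm_num),
        ENNReal.mul_top (by simpa using hrd.2), top_add, top_add] at ht
      exact not_top_lt ht
    have hint : Integrable (fun ω => (X ω : ℝ)) P := by
      refine ⟨hX.coe_nnreal_real.aestronglyMeasurable, ?_⟩
      rw [HasFiniteIntegral]
      simpa [Real.enorm_eq_ofReal_abs] using hfin.lt_top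
    have hE0 : 0 ≤ ∫ ω, (X ω : ℝ) ∂P := integral_nonneg fun ω => (X ω).coe_nonneg
    have hE : ∫⁻ ω, (X ω : ℝ≥0∞) ∂P = ENNReal.ofReal (∫ ω, (X ω : ℝ) ∂P) := by
      rw [ofReal_integral_eq_lintegral_ofReal hint
        (Filter.Eventually.of_forall fun ω => (X ω).coe_nonneg)]
      simp
    have hq : P Ex * (⨆ ω, (X ω : ℝ≥0∞)) ≠ ∞ := by
      intro htop
      rw [mul_assoc 8 (P Ex), htop, ENNReal.mul_top (by norm_num), add_top] at ht
      exact not_top_lt ht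
    set q := (P Ex * (⨆ ω, (X ω : ℝ≥0∞))).toReal
    have hqof : P Ex * (⨆ ω, (X ω : ℝ≥0∞)) = ENNReal.ofReal q := (ENNReal.ofReal_toReal hq).symm
    have hq0 : 0 ≤ q := ENNReal.toReal_nonneg
    have ht' : 96 * d * √(r * ∫ ω, (X ω : ℝ) ∂P) + 128 * r * d ^ 2 + 8 * q < t := by
      rw [mul_assoc 8 (P Ex), hqof, hE, ← ENNReal.ofReal_coe_nnreal (p := r),
        ← ENNReal.ofReal_coe_nnreal (p := d), ← ENNReal.ofReal_mul (by positivity),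
        ENNReal.ofReal_rpow_of_nonneg (by positivity) (by norm_num), ← Real.sqrt_eq_rpow,
        ← ENNReal.ofReal_pow (by positivity), show (96 : ℝ≥0∞) = ENNReal.ofReal 96 by simp,
        show (128 : ℝ≥0∞) = ENNReal.ofReal 128 by simp,
        show (8 : ℝ≥0∞) = ENNReal.ofReal 8 by simp, ← ENNReal.ofReal_mul (by positivity),
        ← ENNReal.ofReal_mul (by positivity), ← ENNReal.ofReal_mul (by positivity),
        ← ENNReal.ofReal_mul (by positivity), ← ENNReal.ofReal_mul (by positivity),
        ← ENNReal.ofReal_add (by positivity) (by positivity),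
        ← ENNReal.ofReal_add (by positivity) (by positivity),
        ENNReal.ofReal_lt_ofReal_iff_of_nonneg (by positivity)] at ht
      exact ht
    have hmain := hcert'.measureReal_abs_sub_integral_le μ hX hm hr hd hint hq0
      (by rw [← hP, hPE, hqof]) ht'
    rw [← hP, hPEr] at hmain
    refine ⟨hint, hmain, fun hz => ?_⟩
    rcases hz with hz | hz
    · exact (hrd.1 hz).elim
    · exact (hrd.2 hz).elim
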